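/- Let $k\ge 1$, $\lambda>0$, $\alpha\in\left(-\frac{k+1}{2},-\frac{k}{2}\right)$, and let $W$ be Gaussian white noise on $\mathbb R$ (a centered Gaussian family indexed by the Borel sets of finite Lebesgue measure with $E(W(A)W(B))=|A\cap B|$) on a probability space. Let $g$ be a nonzero measurable function on $\mathbb R_+^k=(0,\infty)^k$ such that $g(c\mathbf x)=c^{\alpha}g(\mathbf x)$ for all $c>0$, and $\int_{\mathbb R_+^k}|g(\mathbf x)g(\mathbf 1+\mathbf x)|\,e^{-2\lambda u(x_1+\dots+x_k)}\,d\mathbf x<\infty$ for every $u>0$. Let $I_k$ denote the $k$-fold multiple Wiener–Itô integral with respect to $W$, and for $t\in\mathbb R$ put $$Z^\lambda(t)=I_k(h_t^\lambda),\qquad h^\lambda_t(x_1,\dots,x_k)=\int_0^t g(s-x_1,\dots,s-x_k)\prod_{i=1}^k e^{-\lambda(s-x_i)}\,1_{\{s>x_1,\dots,s>x_k\}}\,ds$$ (with $\int_0^t=-\int_t^0$ if $t<0$). Suppose that $g(x_1,\dots,x_k)=\prod_{i=1}^k g_1(x_i)$ for a function $g_1:[0,\infty)\to\mathbb R$ with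 $g_1(0)=0$. Then $Z^\lambda(t)$ is well defined for all $t$, and for all $t,s\in\mathbb R$ $$E\big(Z^\lambda(t)Z^\lambda(s)\big)=k!\int_0^t\int_0^s e^{-\lambda k|u-v|}\,|u-v|^{2\alpha+k}\left[\int_0^\infty g_1(x)\,g_1(1+x)\,e^{-2\lambda|u-v|x}\,dx\right]^k du\,dv,$$ where all the integrals converge absolutely. -/

import Mathlib

open MeasureTheory ProbabilityTheory Filter Topology Set
open scoped ENNReal

noncomputable section

/-- Gaussian white noise on `ℝ` with Lebesgue control measure: on the Borel sets of finite measure,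
`W` is a centered Gaussian family with `E (W A * W B) = |A ∩ B|`. The values of `W` on other sets
play no role. -/
structure IsGaussianWhiteNoise {Ω : Type*} [MeasurableSpace Ω] (W : Set ℝ → Ω → ℝ)
    (P : Measure Ω) : Prop where
  gaussian : IsGaussianProcess
    (fun A : {A : Set ℝ // MeasurableSet A ∧ volume A ≠ ∞} => W A.1) P
  mean : ∀ A : Set ℝ, MeasurableSet A → volume A ≠ ∞ → ∫ ω, W A ω ∂P = 0
  covariance : ∀ A B : Set ℝ, MeasurableSet A → volume A ≠ ∞ → MeasurableSet B → volume B ≠ ∞ →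
    ∫ ω, W A ω * W B ω ∂P = volume.real (A ∩ B)

/-- A rectangle `A₁ × ⋯ × A_k` in `ℝᵏ` with pairwise disjoint Borel sides of finite measure (so
that it does not meet any diagonal `xᵢ = xⱼ`, `i ≠ j`). -/
structure OffDiagonalRectangle (k : ℕ) where
  side : Fin k → Set ℝ
  measurableSet_side : ∀ i, MeasurableSet (side i)
  volume_side_ne_top : ∀ i, volume (side i) ≠ ∞
  disjoint_side : ∀ i j, i ≠ j → Disjoint (side i) (side j)

/-- Elementary integrands: finite (formal) linear combinations of off-diagonal rectangles. -/
abbrev ElementaryIntegrand (k : ℕ) := OffDiagonalRectangle k →₀ ℝ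

/-- The function `∑ c_R 1_R` on `ℝᵏ` given by an elementary integrand. -/
def ElementaryIntegrand.toFun {k : ℕ} (F : ElementaryIntegrand k) (x : Fin k → ℝ) : ℝ :=
  F.sum fun R c => c * (Set.univ.pi R.side).indicator (fun _ => (1 : ℝ)) x

/-- The multiple integral `∑ c_R W(A₁) ⋯ W(A_k)` of an elementary integrand `∑ c_R 1_R`,
`R = A₁ × ⋯ × A_k`. -/
def ElementaryIntegrand.integral {Ω : Type*} {k : ℕ} (F : ElementaryIntegrand k)
    (W : Set ℝ → Ω → ℝ) (ω : Ω) : ℝ :=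
  F.sum fun R c => c * ∏ i, W (R.side i) ω

/-- `X` is (a version of) the multiple Wiener–Itô integral of `f ∈ L²(ℝᵏ)` with respect to `W`:
it is the limit in `L²(P)` of the integrals of elementary integrands which converge to `f` in
`L²(ℝᵏ)`. -/
def IsMultipleWienerIntegral {Ω : Type*} [MeasurableSpace Ω] (W : Set ℝ → Ω → ℝ) (P : Measure Ω)
    {k : ℕ} (f : (Fin k → ℝ) → ℝ) (X : Ω → ℝ) : Prop :=
  MemLp f 2 volume ∧ MemLp X 2 P ∧
    ∃ F : ℕ → ElementaryIntegrand k,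
      Tendsto (fun n => eLpNorm (fun x => f x - (F n).toFun x) 2 volume) atTop (𝓝 0) ∧
      Tendsto (fun n => eLpNorm (fun ω => X ω - (F n).integral W ω) 2 P) atTop (𝓝 0)

open Classical in
/-- The multiple Wiener–Itô integral `I_k(f)`, as a random variable (a version of it; it is unique
up to `P`-null sets). It is `0` by convention if the integral does not exist. -/
def multipleWienerIntegral {Ω : Type*} [MeasurableSpace Ω] (W : Set ℝ → Ω → ℝ) (P : Measure Ω)
    {k : ℕ} (f : (Fin k → ℝ) → ℝ) : Ω → ℝ :=
  if h : ∃ X, IsMultipleWienerIntegral W P f X then h.choose else 0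

/-- The positive orthant `{x ∈ ℝᵏ : xᵢ > 0 for all i}`. -/
def positiveOrthant (k : ℕ) : Set (Fin k → ℝ) := {x | ∀ i, 0 < x i}

/-- Generalized tempered Hermite kernels on the positive orthant of `ℝᵏ`, with homogeneity
exponent `α` and tempering parameter `lam`. The values of `g` off the orthant play no role. -/
structure IsTemperedHermiteKernel (k : ℕ) (α lam : ℝ) (g : (Fin k → ℝ) → ℝ) : Prop where
  exponent_mem : α ∈ Set.Ioo (-((k : ℝ) + 1) / 2) (-(k : ℝ) / 2)
  measurable : Measurable ((positiveOrthant k).domRestrict g)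
  nonzero : ∃ x ∈ positiveOrthant k, g x ≠ 0
  homogeneous : ∀ c : ℝ, 0 < c → ∀ x ∈ positiveOrthant k, g (c • x) = c ^ α * g x
  integrable : ∀ u : ℝ, 0 < u →
    IntegrableOn (fun x => |g x * g (1 + x)| * ∏ i, Real.exp (-2 * lam * u * x i))
      (positiveOrthant k) volume

/-- The tempered kernel
`h_t(x) = ∫₀ᵗ g(s - x₁, …, s - x_k) ∏ᵢ e^{-λ(s - xᵢ)} 1_{s > x₁, …, s > x_k} ds`. -/
def temperedKernel {k : ℕ} (g : (Fin k → ℝ) → ℝ) (lam t : ℝ) (x : Fin k → ℝ) : ℝ :=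
  ∫ s in (0 : ℝ)..t,
    {s : ℝ | ∀ i, x i < s}.indicator
      (fun s => g (fun i => s - x i) * ∏ i, Real.exp (-lam * (s - x i))) s

/-- The tempered generalized Hermite process `Z(t) = I_k(h_t)`. -/
def temperedHermiteProcess {Ω : Type*} [MeasurableSpace Ω] (W : Set ℝ → Ω → ℝ) (P : Measure Ω)
    {k : ℕ} (g : (Fin k → ℝ) → ℝ) (lam t : ℝ) : Ω → ℝ :=
  multipleWienerIntegral W P (temperedKernel g lam t)

/-- The integrand
`e^{-λ k r} r^{2α + k} (∫₀^∞ g₁(x) g₁(1 + x) e^{-2 λ r x} dx)ᵏ`, to be taken at `r = |u - v|`. -/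
def covarianceIntegrand (k : ℕ) (α lam : ℝ) (g₁ : ℝ → ℝ) (r : ℝ) : ℝ :=
  Real.exp (-lam * k * r) * r ^ (2 * α + k) *
    (∫ x in Set.Ioi (0 : ℝ), g₁ x * g₁ (1 + x) * Real.exp (-2 * lam * r * x)) ^ k

end

/-! The kernel `g` is positively homogeneous and a product, so on `(0, ∞)` the factor `g₁` is a
constant multiple of the power `x ^ (α / k)`
(`IsTemperedHermiteKernel.exists_eq_const_mul_rpow`). Since `-1 < α / k < -1 / 2`, the function
`g₁(x) g₁(1 + x)` is integrable on `(0, ∞)`, and rescaling by `r = |u - v|` evaluates the overlap of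
the translates by `u` and `v` of the one-variable kernel `g₁(y) e^{-λ y} 1_{y > 0}`. Its `k`-th
power is the covariance integrand, which is `O(r ^ (2 α + k))` with `2 α + k > -1`, hence integrable
on bounded rectangles. By Tonelli, the triple integral of the product of two translated
kernels over `(u, v, x)` converges absolutely, and Fubini gives both `h_t ∈ L²(ℝᵏ)` and the value
of `∫ h_t h_s` (`integral_mul_temperedKernel`).

On the probabilistic side, the sides of two off-diagonal rectangles are cut into the cells of their
common refinement. The noise of the cells is independent and centered, so in the product of the two
elementary integrals only those monomials have nonzero mean in which each cell occurs twice; these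
are indexed by the permutations of `Fin k`
(`IsGaussianWhiteNoise.integral_prod_mul_prod`). In terms of `L²` this says
`⟪I F, I G⟫ = ∑ σ, ⟪F, G ∘ σ⟫` (`IsGaussianWhiteNoise.inner_integralLp`), whence
`‖I F‖² ≤ k! ‖F‖²`. Elementary integrands are dense in `L²(ℝᵏ)`
(`ElementaryIntegrand.denseRange_toLp`), so the integral exists for all square integrable functions,
and, in the limit, `E[I(f) I(g)] = k! ∫ f g` if `g` is symmetric, as `h_s` is. -/

/-! ### Homogeneous product kernels and the overlap in one variable -/

/-- If the product `f (x₀) f (x₁) ⋯ f (xₙ)` is homogeneous of degree `α` on the positive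
orthant and `f` has no zeros on `(0, ∞)`, then `f` is homogeneous of degree `α / (n + 1)`.
It suffices to know the homogeneity at the points `(a, b, …, b)`. -/
theorem eq_mul_rpow_of_prod_homogeneous {n : ℕ} {α : ℝ} {f : ℝ → ℝ}
    (hne : ∀ y, 0 < y → f y ≠ 0)
    (hf : ∀ c : ℝ, 0 < c → ∀ a b : ℝ, 0 < a → 0 < b →
      f (c * a) * f (c * b) ^ n = c ^ α * (f a * f b ^ n))
    {y : ℝ} (hy : 0 < y) : f y = f 1 * y ^ (α / (n + 1 : ℕ)) := by
  set γ := α / (n + 1 : ℕ) with hγ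
  have hpow : ∀ c : ℝ, 0 < c → c ^ α = (c ^ γ) ^ (n + 1) := fun c hc => by
    rw [← Real.rpow_mul_natCast hc.le, hγ, div_mul_cancel₀ _ (by positivity)]
  -- the ratio `f (c a) / (c ^ γ f a)` does not depend on `a`, and its `(n + 1)`-st power is `1`
  let ρ : ℝ → ℝ → ℝ := fun c a => f (c * a) / (c ^ γ * f a)
  have hρ : ∀ c a, 0 < c → 0 < a → f (c * a) = ρ c a * (c ^ γ * f a) := fun c a hc ha => by
    have := hne a ha
    have := (Real.rpow_pos_of_pos hc γ).ne'
    simp only [ρ]; field_simp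
  have key : ∀ c a b, 0 < c → 0 < a → 0 < b → ρ c a * ρ c b ^ n = 1 := fun c a b hc ha hb => by
    have h := hf c hc a b ha hb
    rw [hρ c a hc ha, hρ c b hc hb, hpow c hc] at h
    have h1 := hne a ha
    have h2 := hne b hb
    have h3 := (Real.rpow_pos_of_pos hc γ).ne'
    have : (ρ c a * ρ c b ^ n) * ((c ^ γ) ^ (n + 1) * (f a * f b ^ n))
        = 1 * ((c ^ γ) ^ (n + 1) * (f a * f b ^ n)) := by
      linear_combination h
    exact mul_right_cancel₀ (by positivity) this
  have hindep : ∀ c a b, 0 < c → 0 < a → 0 < b → ρ c a = ρ c b := fun c a b hc ha hb => by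
    have h1 := key c a b hc ha hb
    have h2 := key c b b hc hb hb
    have : ρ c b ^ n ≠ 0 := fun h => by simp [h] at h1
    exact mul_right_cancel₀ this (h1.trans h2.symm)
  set c := √y with hc
  have hc0 : 0 < c := Real.sqrt_pos.2 hy
  have hcc : c * c = y := Real.mul_self_sqrt hy.le
  have hsq : ρ c 1 * ρ c 1 = 1 := by
    have h := key c 1 1 hc0 one_pos one_pos
    rw [← pow_succ'] at h
    rw [← abs_mul_abs_self, (pow_eq_one_iff_of_nonneg (abs_nonneg (ρ c 1)) n.succ_ne_zero).1
      (by rw [← abs_pow, h, abs_one]), one_mul]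
  have h1 := hρ c c hc0 hc0
  have h2 := hρ c 1 hc0 one_pos
  rw [mul_one] at h2
  rw [hcc, h2, hindep c c 1 hc0 hc0 one_pos] at h1
  rw [h1, ← hcc, Real.mul_rpow hc0.le hc0.le]
  linear_combination (c ^ γ * c ^ γ * f 1) * hsq

/-- A tempered Hermite kernel that is a product of functions of one variable is a product of
powers. The signs of `g₁` cannot vary: their variation is a character of `(0, ∞)` with values in
`{1, -1}`, and every positive number is a square. -/
theorem IsTemperedHermiteKernel.exists_eq_const_mul_rpow {k : ℕ} (hk : 1 ≤ k) {α lam : ℝ}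
    {g : (Fin k → ℝ) → ℝ} (hg : IsTemperedHermiteKernel k α lam g) {g₁ : ℝ → ℝ}
    (hprod : ∀ x ∈ positiveOrthant k, g x = ∏ i, g₁ (x i)) :
    ∃ C : ℝ, ∀ y, 0 < y → g₁ y = C * y ^ (α / k) := by
  obtain ⟨n, rfl⟩ : ∃ n, k = n + 1 := ⟨k - 1, by omega⟩
  have hscale : ∀ c : ℝ, 0 < c → ∀ x ∈ positiveOrthant (n + 1),
      ∏ i, g₁ (c * x i) = c ^ α * ∏ i, g₁ (x i) := fun c hc x hx => by
    have h := hg.homogeneous c hc x hx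
    rw [hprod x hx, hprod (c • x) (fun i => mul_pos hc (hx i))] at h
    exact h
  refine ⟨g₁ 1, fun y hy => eq_mul_rpow_of_prod_homogeneous ?_ ?_ hy⟩
  · intro y hy h0
    obtain ⟨x, hx, hgx⟩ := hg.nonzero
    have hx0 := hx 0
    have h := hscale (y / x 0) (by positivity) x hx
    rw [Finset.prod_eq_zero (Finset.mem_univ 0) (by rwa [div_mul_cancel₀ _ hx0.ne']),
      ← hprod x hx] at h
    exact mul_ne_zero (Real.rpow_pos_of_pos (by positivity) α).ne' hgx h.symm
  · intro c hc a b ha hb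
    have h := hscale c hc (Fin.cons a fun _ => b) (fun i => by cases i using Fin.cases <;> simpa)
    simpa [Fin.prod_univ_succ] using h

theorem integrableOn_rpow_mul_one_add_rpow {γ : ℝ} (h1 : -1 < γ) (h2 : γ < -1 / 2) :
    IntegrableOn (fun x : ℝ => x ^ γ * (1 + x) ^ γ) (Ioi 0) := by
  have hm : Measurable fun x : ℝ => x ^ γ * (1 + x) ^ γ := by fun_prop
  rw [← Ioc_union_Ioi_eq_Ioi zero_le_one]
  refine IntegrableOn.union ?_ ?_
  · refine Integrable.mono' (g := fun x => x ^ γ)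
      ((intervalIntegrable_iff_integrableOn_Ioc_of_le zero_le_one).1
        (intervalIntegral.intervalIntegrable_rpow' h1)) hm.aestronglyMeasurable ?_
    filter_upwards [ae_restrict_mem measurableSet_Ioc] with x hx
    have h0 := Real.rpow_nonneg hx.1.le γ
    have h3 : (1 + x) ^ γ ≤ 1 := Real.rpow_le_one_of_one_le_of_nonpos (by linarith [hx.1])
      (by linarith)
    have h4 : 0 ≤ (1 + x) ^ γ := Real.rpow_nonneg (by linarith [hx.1]) γ
    rw [Real.norm_of_nonneg (by positivity)]
    nlinarith
  · refine Integrable.mono' (g := fun x => x ^ (γ + γ))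
      (integrableOn_Ioi_rpow_of_lt (by linarith) one_pos) hm.aestronglyMeasurable ?_
    filter_upwards [ae_restrict_mem measurableSet_Ioi] with x hx
    have hx : 1 < x := hx
    have h0 := Real.rpow_nonneg (by linarith : 0 ≤ x) γ
    have h3 : (1 + x) ^ γ ≤ x ^ γ := Real.rpow_le_rpow_of_nonpos (by linarith) (by linarith)
      (by linarith)
    have h4 : 0 ≤ (1 + x) ^ γ := Real.rpow_nonneg (by linarith) γ
    rw [Real.norm_of_nonneg (by positivity), Real.rpow_add (by linarith)]
    nlinarith

theorem integrableOn_mul_exp_neg {f : ℝ → ℝ} (hf : IntegrableOn f (Ioi 0)) {c : ℝ} (hc : 0 ≤ c) :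
    IntegrableOn (fun x => f x * Real.exp (-c * x)) (Ioi 0) := by
  refine Integrable.mono hf
    (hf.aestronglyMeasurable.mul (by fun_prop : Continuous fun x : ℝ =>
      Real.exp (-c * x)).aestronglyMeasurable) ?_
  filter_upwards [ae_restrict_mem measurableSet_Ioi] with x hx
  have hx : 0 < x := hx
  rw [norm_mul, Real.norm_of_nonneg (Real.exp_nonneg _)]
  exact mul_le_of_le_one_right (norm_nonneg _) (Real.exp_le_one_iff.2 (by nlinarith))

/-- The function `y ↦ f y e^{-λ y}` on `(0, ∞)`, extended by `0`. -/
noncomputable def temperedTruncation (f : ℝ → ℝ) (lam y : ℝ) : ℝ :=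
  (Ioi (0 : ℝ)).indicator (fun y => f y * Real.exp (-lam * y)) y

section Overlap

variable {g₁ : ℝ → ℝ} {C γ lam : ℝ}

theorem measurable_temperedTruncation (hC : ∀ y, 0 < y → g₁ y = C * y ^ γ) :
    Measurable (temperedTruncation g₁ lam) := by
  have : temperedTruncation g₁ lam
      = (Ioi (0 : ℝ)).indicator (fun y => C * y ^ γ * Real.exp (-lam * y)) := by
    refine indicator_congr (f := fun y => g₁ y * Real.exp (-lam * y)) fun y hy => ?_
    beta_reduce; rw [hC y hy]
  rw [this]
  exact Measurable.indicator (by fun_prop) measurableSet_Ioi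

theorem temperedTruncation_mul_nonneg (hC : ∀ y, 0 < y → g₁ y = C * y ^ γ) (a b : ℝ) :
    0 ≤ temperedTruncation g₁ lam a * temperedTruncation g₁ lam b := by
  by_cases ha : 0 < a
  · by_cases hb : 0 < b
    · have h1 := Real.rpow_nonneg ha.le γ
      have h2 := Real.rpow_nonneg hb.le γ
      simp only [temperedTruncation, indicator_of_mem (mem_Ioi.2 ha),
        indicator_of_mem (mem_Ioi.2 hb), hC a ha, hC b hb]
      have : 0 ≤ C * C * (a ^ γ * b ^ γ * Real.exp (-lam * a) * Real.exp (-lam * b)) :=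
        mul_nonneg (mul_self_nonneg C) (by positivity)
      linarith
    · simp [temperedTruncation, hb]
  · simp [temperedTruncation, ha]

theorem integrableOn_mul_shift (hC : ∀ y, 0 < y → g₁ y = C * y ^ γ)
    (h1 : -1 < γ) (h2 : γ < -1 / 2) :
    IntegrableOn (fun x : ℝ => g₁ x * g₁ (1 + x)) (Ioi 0) := by
  refine ((integrableOn_rpow_mul_one_add_rpow h1 h2).const_mul (C * C)).congr ?_
  filter_upwards [ae_restrict_mem measurableSet_Ioi] with x hx
  have hx : 0 < x := hx
  rw [hC x hx, hC (1 + x) (by linarith)]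
  ring

theorem integrableOn_mul_shift_mul_exp (hC : ∀ y, 0 < y → g₁ y = C * y ^ γ)
    (h1 : -1 < γ) (h2 : γ < -1 / 2) (hlam : 0 < lam) {r : ℝ} (hr : 0 ≤ r) :
    IntegrableOn (fun x : ℝ => g₁ x * g₁ (1 + x) * Real.exp (-2 * lam * r * x)) (Ioi 0) := by
  convert integrableOn_mul_exp_neg (integrableOn_mul_shift hC h1 h2)
    (by positivity : 0 ≤ 2 * lam * r) using 5
  ring

/-- The substitution is `x = u - (v - u) y`, followed by the homogeneity of `g₁`. -/
theorem temperedTruncation_overlap_of_lt (hC : ∀ y, 0 < y → g₁ y = C * y ^ γ)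
    (h1 : -1 < γ) (h2 : γ < -1 / 2) (hlam : 0 < lam) {u v : ℝ} (huv : u < v) :
    Integrable (fun x => temperedTruncation g₁ lam (u - x) * temperedTruncation g₁ lam (v - x)) ∧
    ∫ x, temperedTruncation g₁ lam (u - x) * temperedTruncation g₁ lam (v - x)
      = Real.exp (-lam * (v - u)) * (v - u) ^ (2 * γ + 1) *
        ∫ x in Ioi (0 : ℝ), g₁ x * g₁ (1 + x) * Real.exp (-2 * lam * (v - u) * x) := by
  set r := v - u with hr
  have hr0 : 0 < r := sub_pos.2 huv
  let f : ℝ → ℝ := fun y => temperedTruncation g₁ lam y * temperedTruncation g₁ lam (y + r)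
  have hf : (fun x => temperedTruncation g₁ lam (u - x) * temperedTruncation g₁ lam (v - x))
      = fun x => f (u - x) := by
    ext x; simp only [f, hr]; congr 2; ring
  have hind : f = (Ioi (0 : ℝ)).indicator f := by
    refine (indicator_eq_self.2 fun y hy => ?_).symm
    by_contra h
    exact hy (by simp [f, temperedTruncation, indicator_of_notMem h])
  have hscale : ∀ x ∈ Ioi (0 : ℝ), f (r * x) = Real.exp (-lam * r) * r ^ (2 * γ) *
      (g₁ x * g₁ (1 + x) * Real.exp (-2 * lam * r * x)) := fun x hx => by
    have hx : 0 < x := hx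
    have e1 : 0 < r * x := by positivity
    have e2 : 0 < r * x + r := by positivity
    have e3 : r * x + r = r * (1 + x) := by ring
    simp only [f, temperedTruncation, indicator_of_mem (mem_Ioi.2 e1),
      indicator_of_mem (mem_Ioi.2 e2)]
    rw [hC _ e1, hC _ e2, hC x hx, hC (1 + x) (by linarith), e3, Real.mul_rpow hr0.le hx.le,
      Real.mul_rpow hr0.le (by linarith), two_mul γ, Real.rpow_add hr0]
    have : Real.exp (-lam * r) * Real.exp (-2 * lam * r * x)
        = Real.exp (-lam * (r * x)) * Real.exp (-lam * (r * (1 + x))) := by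
      rw [← Real.exp_add, ← Real.exp_add]; congr 1; ring
    linear_combination (-(C * C * r ^ γ * r ^ γ * x ^ γ * (1 + x) ^ γ)) * this
  have hint : IntegrableOn f (Ioi 0) := by
    have h := (integrableOn_Ioi_comp_mul_left_iff f 0 hr0).1
    rw [mul_zero] at h
    refine h (Integrable.congr ((integrableOn_mul_shift_mul_exp hC h1 h2 hlam hr0.le).const_mul
      (Real.exp (-lam * r) * r ^ (2 * γ))) ?_)
    filter_upwards [ae_restrict_mem measurableSet_Ioi] with x hx
    rw [hscale x hx]
  have hval := integral_comp_mul_left_Ioi f 0 hr0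
  rw [mul_zero, setIntegral_congr_fun measurableSet_Ioi hscale, integral_const_mul] at hval
  have hf_int : Integrable f := by rw [hind]; exact hint.integrable_indicator measurableSet_Ioi
  rw [hf]
  refine ⟨hf_int.comp_sub_left u, ?_⟩
  rw [integral_sub_left_eq_self f volume u, hind, integral_indicator measurableSet_Ioi,
    Real.rpow_add_one hr0.ne']
  rw [smul_eq_mul, eq_inv_mul_iff_mul_eq₀ hr0.ne'] at hval
  rw [← hval]; ring

/-- The overlap of two translates of the one-variable kernel. -/
theorem temperedTruncation_overlap (hC : ∀ y, 0 < y → g₁ y = C * y ^ γ)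
    (h1 : -1 < γ) (h2 : γ < -1 / 2) (hlam : 0 < lam) {u v : ℝ} (huv : u ≠ v) :
    Integrable (fun x => temperedTruncation g₁ lam (u - x) * temperedTruncation g₁ lam (v - x)) ∧
    ∫ x, temperedTruncation g₁ lam (u - x) * temperedTruncation g₁ lam (v - x)
      = Real.exp (-lam * |u - v|) * |u - v| ^ (2 * γ + 1) *
        ∫ x in Ioi (0 : ℝ), g₁ x * g₁ (1 + x) * Real.exp (-2 * lam * |u - v| * x) := by
  rcases lt_or_gt_of_ne huv with h | h
  · rw [abs_sub_comm, abs_of_pos (sub_pos.2 h)]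
    exact temperedTruncation_overlap_of_lt hC h1 h2 hlam h
  · rw [abs_of_pos (sub_pos.2 h)]
    simp_rw [mul_comm (temperedTruncation g₁ lam (u - _))]
    exact temperedTruncation_overlap_of_lt hC h1 h2 hlam h

end Overlap

/-! ### The covariance integrand and the kernel in L² -/

theorem integrableOn_uIoc_prod_abs_sub_rpow {β : ℝ} (hβ : -1 < β) (s t : ℝ) :
    IntegrableOn (fun p : ℝ × ℝ => |p.1 - p.2| ^ β) (uIoc 0 s ×ˢ uIoc 0 t) := by
  set M := |s| + |t| with hM
  have hM0 : 0 ≤ M := by positivity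
  have h0 : IntegrableOn (fun w : ℝ => |w| ^ β) (Icc (-M) M) := by
    have h1 : IntervalIntegrable (fun w : ℝ => |w| ^ β) volume 0 M :=
      (intervalIntegral.intervalIntegrable_rpow' hβ).congr fun w hw => by
        rw [uIoc_of_le hM0] at hw; rw [abs_of_pos hw.1]
    have h2 : IntervalIntegrable (fun w : ℝ => |w| ^ β) volume (-M) 0 := by
      simpa using ((IntervalIntegrable.iff_comp_neg (by simp)).1 h1).symm
    rw [integrableOn_Icc_iff_integrableOn_Ioc]
    exact (intervalIntegrable_iff_integrableOn_Ioc_of_le (by linarith)).1 (h2.trans h1)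
  have h1 : Integrable ((Icc (-M) M).indicator fun w : ℝ => |w| ^ β) :=
    h0.integrable_indicator measurableSet_Icc
  have h2 : Integrable ((uIoc 0 t).indicator fun _ : ℝ => (1 : ℝ)) :=
    (integrable_indicator_iff measurableSet_uIoc).2 (integrableOn_const (by simp))
  have h3 := (h2.convolution_integrand (ContinuousLinearMap.mul ℝ ℝ) h1).integrableOn
    (s := uIoc 0 s ×ˢ uIoc 0 t)
  refine h3.congr ?_
  filter_upwards [ae_restrict_mem (measurableSet_uIoc.prod measurableSet_uIoc)] with p hp
  have hmem : p.1 - p.2 ∈ Icc (-M) M := by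
    have e1 := abs_sub_left_of_mem_uIcc (uIoc_subset_uIcc hp.1)
    have e2 := abs_sub_left_of_mem_uIcc (uIoc_subset_uIcc hp.2)
    rw [sub_zero, sub_zero] at e1 e2
    exact abs_le.1 ((abs_sub _ _).trans (by linarith))
  simp [indicator_of_mem hp.2, indicator_of_mem hmem]

/-- The diagonal is null. It has to be avoided since the overlap may be infinite on it. -/
theorem ae_fst_ne_snd (s : Set (ℝ × ℝ)) :
    ∀ᵐ p ∂(volume.restrict s : Measure (ℝ × ℝ)), p.1 ≠ p.2 := by
  refine ae_restrict_of_ae ?_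
  have hm : MeasurableSet {p : ℝ × ℝ | p.1 ≠ p.2} :=
    (measurableSet_eq_fun measurable_fst measurable_snd).compl
  refine (Measure.ae_prod_iff_ae_ae hm).2 (Eventually.of_forall fun x => ?_)
  exact (measure_eq_zero_iff_ae_notMem.1 (measure_singleton x)).mono fun y hy h => hy h.symm

section Kernel

variable {k : ℕ} {α lam C : ℝ} {g₁ : ℝ → ℝ}

theorem temperedKernel_eq_integral_prod {g : (Fin k → ℝ) → ℝ}
    (hprod : ∀ x ∈ positiveOrthant k, g x = ∏ i, g₁ (x i)) (t : ℝ) (x : Fin k → ℝ) :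
    temperedKernel g lam t x = ∫ s in (0 : ℝ)..t, ∏ i, temperedTruncation g₁ lam (s - x i) := by
  unfold temperedKernel
  congr 1 with s
  by_cases h : ∀ i, x i < s
  · rw [indicator_of_mem (by exact h), hprod _ (fun i => sub_pos.2 (h i)),
      ← Finset.prod_mul_distrib]
    refine Finset.prod_congr rfl fun i _ => ?_
    rw [temperedTruncation, indicator_of_mem (mem_Ioi.2 (sub_pos.2 (h i)))]
  · rw [indicator_of_notMem (by exact h)]
    obtain ⟨i, hi⟩ := not_forall.1 h
    refine (Finset.prod_eq_zero (Finset.mem_univ i) ?_).symm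
    rw [temperedTruncation, indicator_of_notMem]
    simpa using hi

theorem temperedKernel_comp_perm {g : (Fin k → ℝ) → ℝ}
    (hprod : ∀ x ∈ positiveOrthant k, g x = ∏ i, g₁ (x i)) (t : ℝ) (σ : Equiv.Perm (Fin k))
    (x : Fin k → ℝ) : temperedKernel g lam t (x ∘ σ) = temperedKernel g lam t x := by
  simp_rw [temperedKernel_eq_integral_prod hprod, Function.comp_apply]
  congr 1 with s
  exact Equiv.prod_comp σ fun i => temperedTruncation g₁ lam (s - x i)

theorem neg_one_lt_exponent_div_lt (hk : 1 ≤ k)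
    (hα : α ∈ Ioo (-((k : ℝ) + 1) / 2) (-(k : ℝ) / 2)) :
    -1 < α / k ∧ α / k < -1 / 2 := by
  have hk' : (1 : ℝ) ≤ k := by exact_mod_cast hk
  obtain ⟨h1, h2⟩ := hα
  constructor
  · rw [lt_div_iff₀ (by linarith)]; linarith
  · rw [div_lt_iff₀ (by linarith)]; linarith

theorem abs_covarianceIntegrand_le (hk : 1 ≤ k)
    (hα : α ∈ Ioo (-((k : ℝ) + 1) / 2) (-(k : ℝ) / 2))
    (hlam : 0 < lam) (hC : ∀ y, 0 < y → g₁ y = C * y ^ (α / k)) {r : ℝ} (hr : 0 < r) :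
    |covarianceIntegrand k α lam g₁ r|
      ≤ (∫ x in Ioi (0 : ℝ), ‖g₁ x * g₁ (1 + x)‖) ^ k * r ^ (2 * α + k) := by
  obtain ⟨h1, h2⟩ := neg_one_lt_exponent_div_lt hk hα
  have hG : |∫ x in Ioi (0 : ℝ), g₁ x * g₁ (1 + x) * Real.exp (-2 * lam * r * x)|
      ≤ ∫ x in Ioi (0 : ℝ), ‖g₁ x * g₁ (1 + x)‖ := by
    rw [← Real.norm_eq_abs]
    refine norm_integral_le_of_norm_le (integrableOn_mul_shift hC h1 h2).norm ?_
    filter_upwards [ae_restrict_mem measurableSet_Ioi] with x hx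
    have hx : 0 < x := hx
    rw [norm_mul, Real.norm_of_nonneg (Real.exp_nonneg _)]
    have : 0 < lam * r * x := by positivity
    exact mul_le_of_le_one_right (norm_nonneg _) (Real.exp_le_one_iff.2 (by linarith))
  rw [covarianceIntegrand, abs_mul, abs_mul, abs_pow, Real.abs_exp,
    abs_of_nonneg (Real.rpow_nonneg hr.le _), mul_comm]
  have : 0 ≤ lam * k * r := by positivity
  have he : Real.exp (-lam * k * r) ≤ 1 := Real.exp_le_one_iff.2 (by linarith)
  have hp := Real.rpow_nonneg hr.le (2 * α + k)
  exact mul_le_mul (pow_le_pow_left₀ (abs_nonneg _) hG k) (mul_le_of_le_one_left hp he)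
    (by positivity) (pow_nonneg ((abs_nonneg _).trans hG) k)

/-- The overlap of two translates of the kernel is the covariance integrand: it is the `k`-th power
of the overlap in one variable. -/
theorem prod_temperedTruncation_overlap (hk : 1 ≤ k)
    (hα : α ∈ Ioo (-((k : ℝ) + 1) / 2) (-(k : ℝ) / 2))
    (hlam : 0 < lam) (hC : ∀ y, 0 < y → g₁ y = C * y ^ (α / k)) {u v : ℝ} (huv : u ≠ v) :
    Integrable (fun x : Fin k → ℝ => (∏ i, temperedTruncation g₁ lam (u - x i)) *
      ∏ i, temperedTruncation g₁ lam (v - x i)) ∧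
    ∫ x : Fin k → ℝ, (∏ i, temperedTruncation g₁ lam (u - x i)) *
      ∏ i, temperedTruncation g₁ lam (v - x i) = covarianceIntegrand k α lam g₁ |u - v| := by
  obtain ⟨h1, h2⟩ := neg_one_lt_exponent_div_lt hk hα
  obtain ⟨hi, he⟩ := temperedTruncation_overlap hC h1 h2 hlam huv
  simp_rw [← Finset.prod_mul_distrib]
  refine ⟨Integrable.fintype_prod fun _ => hi, ?_⟩
  rw [integral_fintype_prod_volume_eq_pow
    (fun x => temperedTruncation g₁ lam (u - x) * temperedTruncation g₁ lam (v - x)), he,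
    Fintype.card_fin, covarianceIntegrand, mul_pow, mul_pow, ← Real.exp_nat_mul,
    ← Real.rpow_mul_natCast (abs_nonneg _)]
  have : (k : ℝ) ≠ 0 := by positivity
  congr 3
  · ring
  · field_simp

theorem measurable_prod_temperedTruncation (hC : ∀ y, 0 < y → g₁ y = C * y ^ (α / k)) :
    Measurable fun q : (ℝ × ℝ) × (Fin k → ℝ) => (∏ i, temperedTruncation g₁ lam (q.1.1 - q.2 i)) *
      ∏ i, temperedTruncation g₁ lam (q.1.2 - q.2 i) := by
  have hm := measurable_temperedTruncation (lam := lam) hC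
  exact (Finset.measurable_prod _ fun i _ => hm.comp (by fun_prop)).mul
    (Finset.measurable_prod _ fun i _ => hm.comp (by fun_prop))

theorem integrableOn_covarianceIntegrand (hk : 1 ≤ k)
    (hα : α ∈ Ioo (-((k : ℝ) + 1) / 2) (-(k : ℝ) / 2))
    (hlam : 0 < lam) (hC : ∀ y, 0 < y → g₁ y = C * y ^ (α / k))
    (s t : ℝ) :
    IntegrableOn (fun p : ℝ × ℝ => covarianceIntegrand k α lam g₁ |p.1 - p.2|)
      (uIoc 0 s ×ˢ uIoc 0 t) := by
  have hβ : -1 < 2 * α + k := by linarith [hα.1]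
  refine Integrable.mono' ((integrableOn_uIoc_prod_abs_sub_rpow hβ s t).const_mul
    ((∫ x in Ioi (0 : ℝ), ‖g₁ x * g₁ (1 + x)‖) ^ k)) ?_ ?_
  · refine AEStronglyMeasurable.congr ((measurable_prod_temperedTruncation (lam := lam)
      hC).stronglyMeasurable.integral_prod_right' (ν := volume)).aestronglyMeasurable ?_
    filter_upwards [ae_fst_ne_snd _] with p hp
    exact (prod_temperedTruncation_overlap hk hα hlam hC hp).2
  · filter_upwards [ae_fst_ne_snd _] with p hp
    exact abs_covarianceIntegrand_le hk hα hlam hC (abs_pos.2 (sub_ne_zero.2 hp))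

/-- The absolute convergence needed for Fubini. The integrand is nonnegative, because the sign of
`g₁` is constant on `(0, ∞)`. -/
theorem integrable_prod_temperedTruncation (hk : 1 ≤ k)
    (hα : α ∈ Ioo (-((k : ℝ) + 1) / 2) (-(k : ℝ) / 2))
    (hlam : 0 < lam) (hC : ∀ y, 0 < y → g₁ y = C * y ^ (α / k)) (s t : ℝ) :
    Integrable (fun q : (ℝ × ℝ) × (Fin k → ℝ) =>
      (∏ i, temperedTruncation g₁ lam (q.1.1 - q.2 i)) *
        ∏ i, temperedTruncation g₁ lam (q.1.2 - q.2 i))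
      ((volume.restrict (uIoc 0 s ×ˢ uIoc 0 t)).prod volume) := by
  refine (integrable_prod_iff
    (measurable_prod_temperedTruncation hC).aestronglyMeasurable).2 ⟨?_, ?_⟩
  · filter_upwards [ae_fst_ne_snd _] with p hp
    exact (prod_temperedTruncation_overlap hk hα hlam hC hp).1
  · refine (integrableOn_covarianceIntegrand hk hα hlam hC s t).congr ?_
    filter_upwards [ae_fst_ne_snd _] with p hp
    rw [← (prod_temperedTruncation_overlap hk hα hlam hC hp).2]
    congr 1 with x
    rw [Real.norm_of_nonneg]
    rw [← Finset.prod_mul_distrib]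
    exact Finset.prod_nonneg fun i _ => temperedTruncation_mul_nonneg hC _ _

/-- The inner product of two tempered kernels in `L²(ℝᵏ)`. -/
theorem integral_mul_temperedKernel (hk : 1 ≤ k)
    (hα : α ∈ Ioo (-((k : ℝ) + 1) / 2) (-(k : ℝ) / 2))
    (hlam : 0 < lam) (hC : ∀ y, 0 < y → g₁ y = C * y ^ (α / k))
    {g : (Fin k → ℝ) → ℝ}
    (hprod : ∀ x ∈ positiveOrthant k, g x = ∏ i, g₁ (x i)) (t s : ℝ) :
    Integrable (fun x => temperedKernel g lam t x * temperedKernel g lam s x) ∧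
    ∫ x, temperedKernel g lam t x * temperedKernel g lam s x
      = ∫ v in (0 : ℝ)..t, ∫ u in (0 : ℝ)..s, covarianceIntegrand k α lam g₁ |u - v| := by
  have hint := integrable_prod_temperedTruncation hk hα hlam hC s t
  have hcov := integrableOn_covarianceIntegrand hk hα hlam hC s t
  -- the sign of an integral from `0` to `t`
  let ε : ℝ → ℝ := fun t => if 0 ≤ t then 1 else -1
  -- for fixed `x`, a product of two integrals is an integral over the product space, whether or
  -- not the two integrals converge
  have hfac : ∀ x : Fin k → ℝ, temperedKernel g lam t x * temperedKernel g lam s x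
      = (ε t * ε s) * ∫ p in uIoc 0 s ×ˢ uIoc 0 t,
        (∏ i, temperedTruncation g₁ lam (p.1 - x i)) *
          ∏ i, temperedTruncation g₁ lam (p.2 - x i) := fun x => by
    rw [temperedKernel_eq_integral_prod hprod, temperedKernel_eq_integral_prod hprod,
      intervalIntegral.intervalIntegral_eq_integral_uIoc,
      intervalIntegral.intervalIntegral_eq_integral_uIoc, Measure.volume_eq_prod,
      ← Measure.prod_restrict,
      integral_prod_mul (fun u => ∏ i, temperedTruncation g₁ lam (u - x i))
        (fun v => ∏ i, temperedTruncation g₁ lam (v - x i)), smul_eq_mul, smul_eq_mul]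
    simp only [ε]
    ring
  simp_rw [hfac]
  refine ⟨hint.integral_prod_right.const_mul _, ?_⟩
  rw [integral_const_mul, ← integral_integral_swap hint]
  have h1 : ∫ p in uIoc 0 s ×ˢ uIoc 0 t, ∫ x : Fin k → ℝ,
      (∏ i, temperedTruncation g₁ lam (p.1 - x i)) * ∏ i, temperedTruncation g₁ lam (p.2 - x i)
      = ∫ p in uIoc 0 s ×ˢ uIoc 0 t, covarianceIntegrand k α lam g₁ |p.1 - p.2| := by
    refine integral_congr_ae ?_
    filter_upwards [ae_fst_ne_snd _] with p hp
    exact (prod_temperedTruncation_overlap hk hα hlam hC hp).2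
  rw [IntegrableOn, Measure.volume_eq_prod, ← Measure.prod_restrict] at hcov
  rw [h1, Measure.volume_eq_prod, ← Measure.prod_restrict, integral_prod_symm _ hcov]
  simp_rw [intervalIntegral.intervalIntegral_eq_integral_uIoc, smul_eq_mul]
  rw [integral_const_mul, mul_assoc]

theorem memLp_two_temperedKernel (hk : 1 ≤ k)
    (hα : α ∈ Ioo (-((k : ℝ) + 1) / 2) (-(k : ℝ) / 2))
    (hlam : 0 < lam) (hC : ∀ y, 0 < y → g₁ y = C * y ^ (α / k))
    {g : (Fin k → ℝ) → ℝ}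
    (hprod : ∀ x ∈ positiveOrthant k, g x = ∏ i, g₁ (x i)) (t : ℝ) :
    MemLp (temperedKernel g lam t) 2 := by
  have hm := measurable_temperedTruncation (lam := lam) hC
  have hmeas : AEStronglyMeasurable (temperedKernel g lam t) := by
    have : Measurable fun q : (Fin k → ℝ) × ℝ => ∏ i, temperedTruncation g₁ lam (q.2 - q.1 i) :=
      Finset.measurable_prod _ fun i _ => hm.comp (by fun_prop)
    have h := this.stronglyMeasurable.integral_prod_right' (ν := volume.restrict (uIoc 0 t))
    refine (h.const_smul (if 0 ≤ t then (1 : ℝ) else -1)).aestronglyMeasurable.congr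
      (Eventually.of_forall fun x => ?_)
    rw [temperedKernel_eq_integral_prod hprod, intervalIntegral.intervalIntegral_eq_integral_uIoc]
    rfl
  rw [memLp_two_iff_integrable_sq hmeas]
  simp_rw [sq]
  exact (integral_mul_temperedKernel hk hα hlam hC hprod t t).1

end Kernel

/-! ### Moments of white noise on rectangles -/

section Monomials

variable {Ω : Type*} [MeasurableSpace Ω] {P : Measure Ω}

/-- Second moments of squarefree monomials in independent centered random variables. -/
theorem integral_prod_mul_prod_of_iIndepFun {ι : Type*} [Fintype ι] [DecidableEq ι]
    {X : ι → Ω → ℝ} (hX : iIndepFun X P) (hm : ∀ a, AEMeasurable (X a) P)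
    (h0 : ∀ a, ∫ ω, X a ω ∂P = 0) (S T : Finset ι) :
    ∫ ω, (∏ a ∈ S, X a ω) * ∏ a ∈ T, X a ω ∂P
      = if S = T then ∏ a ∈ S, ∫ ω, X a ω * X a ω ∂P else 0 := by
  have := hX.isProbabilityMeasure
  let f : ι → ℝ → ℝ := fun a x => (if a ∈ S then x else 1) * (if a ∈ T then x else 1)
  have hf : ∀ a, Measurable (f a) := fun a => by
    simp only [f]; split_ifs <;> fun_prop
  have h : ∀ ω, (∏ a ∈ S, X a ω) * ∏ a ∈ T, X a ω = ∏ a, f a (X a ω) := fun ω => by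
    simp only [f, Finset.prod_mul_distrib, Finset.prod_ite_mem, Finset.univ_inter]
  simp_rw [h]
  rw [hX.integral_fun_prod_comp hm fun a => (hf a).aestronglyMeasurable]
  split_ifs with hST
  · subst hST
    rw [← Finset.prod_subset (Finset.subset_univ S) fun a _ ha => by simp [f, ha]]
    exact Finset.prod_congr rfl fun a ha => by simp [f, ha]
  · obtain ⟨a, ha⟩ : ∃ a, ¬ (a ∈ S ↔ a ∈ T) := by
      by_contra hne
      push Not at hne
      exact hST (Finset.ext hne)
    refine Finset.prod_eq_zero (Finset.mem_univ a) ?_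
    rw [← h0 a]
    refine integral_congr_ae (Eventually.of_forall fun ω => ?_)
    by_cases hS : a ∈ S <;> by_cases hT : a ∈ T <;> simp_all [f]

/-- A product of random variables with finite moments of all orders is square integrable. -/
theorem memLp_two_prod [IsProbabilityMeasure P] {ι : Type*} (s : Finset ι) {X : ι → Ω → ℝ}
    (hX : ∀ i ∈ s, ∀ p : ℝ≥0∞, p ≠ ∞ → MemLp (X i) p P) :
    MemLp (fun ω => ∏ i ∈ s, X i ω) 2 P := by
  have h := MemLp.prod' (s := s) (p := fun _ => 2 * (s.card : ℝ≥0∞)) fun i hi =>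
    hX i hi _ (ENNReal.mul_ne_top (by simp) (by simp))
  refine h.mono_exponent ?_
  rw [ENNReal.le_inv_iff_le_inv, Finset.sum_const, nsmul_eq_mul]
  rcases s.card.eq_zero_or_pos with h0 | h0
  · simp [h0]
  · rw [ENNReal.mul_inv (by simp) (by simp), mul_left_comm,
      ENNReal.mul_inv_cancel (by positivity) (by simp), mul_one]

end Monomials

/-- Choose one cell in each row `some i` and one in each column `some j` of a grid. The two
selections consist of the same cells exactly if these form the graph of a permutation. -/
theorem image_some_fst_eq_image_some_snd_iff {k : ℕ} (φ ψ : Fin k → Option (Fin k)) :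
    Finset.univ.image (fun i => (some i, φ i)) = Finset.univ.image (fun j => (ψ j, some j)) ↔
      ∃ σ : Equiv.Perm (Fin k), φ = (fun i => some (σ i)) ∧ ψ = fun j => some (σ.symm j) := by
  constructor
  · intro h
    have h1 : ∀ i, ∃ j, ψ j = some i ∧ φ i = some j := fun i => by
      have : (some i, φ i) ∈ Finset.univ.image (fun j => (ψ j, some j)) :=
        h ▸ Finset.mem_image_of_mem _ (Finset.mem_univ i)
      obtain ⟨j, -, hj⟩ := Finset.mem_image.1 this
      exact ⟨j, (Prod.ext_iff.1 hj).1, (Prod.ext_iff.1 hj).2.symm⟩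
    choose τ hτψ hτφ using h1
    have hinj : Function.Injective τ := fun i i' hii => by
      have := hτψ i
      rw [hii, hτψ i'] at this
      exact (Option.some_injective _ this).symm
    let σ := Equiv.ofBijective τ (Finite.injective_iff_bijective.1 hinj)
    refine ⟨σ, funext hτφ, funext fun j => ?_⟩
    obtain ⟨i, rfl⟩ := σ.surjective j
    rw [Equiv.symm_apply_apply]
    exact hτψ i
  · rintro ⟨σ, rfl, rfl⟩
    ext ⟨a, b⟩
    simp only [Finset.mem_image, Finset.mem_univ, true_and, Prod.mk.injEq]
    constructor
    · rintro ⟨i, rfl, rfl⟩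
      exact ⟨σ i, by simp, rfl⟩
    · rintro ⟨j, rfl, rfl⟩
      exact ⟨σ.symm j, rfl, by simp⟩

namespace IsGaussianWhiteNoise

variable {Ω : Type*} [MeasurableSpace Ω] {P : Measure Ω} {W : Set ℝ → Ω → ℝ}

theorem hasGaussianLaw (hW : IsGaussianWhiteNoise W P) {A : Set ℝ} (hA : MeasurableSet A)
    (hA' : volume A ≠ ∞) : HasGaussianLaw (W A) P :=
  hW.gaussian.hasGaussianLaw_eval ⟨A, hA, hA'⟩

theorem memLp (hW : IsGaussianWhiteNoise W P) {A : Set ℝ} (hA : MeasurableSet A)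
    (hA' : volume A ≠ ∞) {p : ℝ≥0∞} (hp : p ≠ ∞) : MemLp (W A) p P :=
  (hW.hasGaussianLaw hA hA').memLp hp

theorem iIndepFun (hW : IsGaussianWhiteNoise W P) {ι : Type*} [Fintype ι] {E : ι → Set ℝ}
    (hE : ∀ a, MeasurableSet (E a)) (hE' : ∀ a, volume (E a) ≠ ∞)
    (hd : Pairwise fun a b => Disjoint (E a) (E b)) : iIndepFun (fun a => W (E a)) P := by
  have := hW.gaussian.isProbabilityMeasure
  have h := (hW.gaussian.comp_right fun a : ι => (⟨E a, hE a, hE' a⟩ :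
    {A : Set ℝ // MeasurableSet A ∧ volume A ≠ ∞})).hasGaussianLaw Finset.univ
  let L : (↥(Finset.univ : Finset ι) → ℝ) →L[ℝ] (ι → ℝ) :=
    ContinuousLinearMap.pi fun a => ContinuousLinearMap.proj ⟨a, Finset.mem_univ a⟩
  have h2 : HasGaussianLaw (fun ω a => W (E a) ω) P := h.map L
  refine h2.iIndepFun_of_covariance_eq_zero fun a b hab => ?_
  rw [covariance_eq_sub (hW.memLp (hE a) (hE' a) (by norm_num))
    (hW.memLp (hE b) (hE' b) (by norm_num)), hW.mean _ (hE a) (hE' a), zero_mul, sub_zero]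
  simpa [(hd hab).inter_eq] using hW.covariance _ _ (hE a) (hE' a) (hE b) (hE' b)

/-- White noise is almost surely finitely additive: the mean square of the difference of the two
sides vanishes. -/
theorem ae_eq_sum (hW : IsGaussianWhiteNoise W P) {ι : Type*} [Fintype ι] {A : Set ℝ}
    {E : ι → Set ℝ} (hA' : volume A ≠ ∞)
    (hE : ∀ a, MeasurableSet (E a)) (hd : Pairwise fun a b => Disjoint (E a) (E b))
    (hA : A = ⋃ a, E a) : W A =ᵐ[P] fun ω => ∑ a, W (E a) ω := by
  classical
  have hAm : MeasurableSet A := hA ▸ MeasurableSet.iUnion hE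
  have hsub : ∀ a, E a ⊆ A := fun a => hA ▸ subset_iUnion E a
  have hE' : ∀ a, volume (E a) ≠ ∞ := fun a => measure_ne_top_of_subset (hsub a) hA'
  have hLA : MemLp (W A) 2 P := hW.memLp hAm hA' (by norm_num)
  have hLE : ∀ a, MemLp (W (E a)) 2 P := fun a => hW.memLp (hE a) (hE' a) (by norm_num)
  have hD : MemLp (fun ω => W A ω - ∑ a, W (E a) ω) 2 P :=
    hLA.sub (memLp_finsetSum _ fun a _ => hLE a)
  have hzero : ∫ ω, (W A ω - ∑ a, W (E a) ω) ^ 2 ∂P = 0 := by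
    have hexp : ∀ ω, (W A ω - ∑ a, W (E a) ω) ^ 2 = W A ω * W A ω
        - 2 * ∑ a, W A ω * W (E a) ω + ∑ a, ∑ b, W (E a) ω * W (E b) ω := fun ω => by
      rw [← Finset.sum_mul_sum, ← Finset.mul_sum]; ring
    have i1 : Integrable (fun ω => W A ω * W A ω) P := hLA.integrable_mul hLA
    have i2 : ∀ a, Integrable (fun ω => W A ω * W (E a) ω) P := fun a => hLA.integrable_mul (hLE a)
    have i3 : ∀ a b, Integrable (fun ω => W (E a) ω * W (E b) ω) P :=
      fun a b => (hLE a).integrable_mul (hLE b)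
    simp_rw [hexp]
    have i4 : Integrable (fun ω => 2 * ∑ a, W A ω * W (E a) ω) P :=
      (integrable_finsetSum _ fun a _ => i2 a).const_mul 2
    have i5 : Integrable (fun ω => W A ω * W A ω - 2 * ∑ a, W A ω * W (E a) ω) P := i1.sub i4
    rw [integral_add i5
      (integrable_finsetSum _ fun a _ => integrable_finsetSum _ fun b _ => i3 a b),
      integral_sub i1 i4,
      integral_const_mul, integral_finsetSum _ fun a _ => i2 a,
      integral_finsetSum _ fun a _ => integrable_finsetSum _ fun b _ => i3 a b]
    simp_rw [integral_finsetSum _ fun b _ => i3 _ b]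
    have e1 : ∫ ω, W A ω * W A ω ∂P = ∑ a, volume.real (E a) := by
      rw [hW.covariance _ _ hAm hA' hAm hA', inter_self, hA,
        measureReal_iUnion_fintype hd hE (fun a => hE' a)]
    have e2 : ∀ a, ∫ ω, W A ω * W (E a) ω ∂P = volume.real (E a) := fun a => by
      rw [hW.covariance _ _ hAm hA' (hE a) (hE' a), inter_eq_right.2 (hsub a)]
    have e3 : ∀ a, ∑ b, ∫ ω, W (E a) ω * W (E b) ω ∂P = volume.real (E a) := fun a => by
      rw [Finset.sum_eq_single a]
      · rw [hW.covariance _ _ (hE a) (hE' a) (hE a) (hE' a), inter_self]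
      · intro b _ hb
        rw [hW.covariance _ _ (hE a) (hE' a) (hE b) (hE' b), (hd hb.symm).inter_eq,
          measureReal_empty]
      · simp
    simp_rw [e1, e2, e3]
    ring
  have := (integral_eq_zero_iff_of_nonneg (fun ω => sq_nonneg _) hD.integrable_sq).1 hzero
  filter_upwards [this] with ω hω
  exact sub_eq_zero.1 (pow_eq_zero_iff two_ne_zero |>.1 hω)

/-- The product formula for two families of sets which are the rows `some i` and the columns
`some j` of a grid of pairwise disjoint cells. The index `none` stands for the part of a row or
column that is not covered by the other family. -/
theorem integral_prod_mul_prod_grid (hW : IsGaussianWhiteNoise W P) {k : ℕ}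
    {E : Option (Fin k) × Option (Fin k) → Set ℝ}
    (hE : ∀ a, MeasurableSet (E a)) (hE' : ∀ a, volume (E a) ≠ ∞)
    (hd : Pairwise fun a b => Disjoint (E a) (E b)) :
    ∫ ω, (∏ i : Fin k, ∑ b, W (E (some i, b)) ω) * ∏ j : Fin k, ∑ a, W (E (a, some j)) ω ∂P
      = ∑ σ : Equiv.Perm (Fin k), ∏ i, volume.real (E (some i, some (σ i))) := by
  classical
  have hind := hW.iIndepFun hE hE' hd
  have hLp : ∀ (m : ℕ) (f : Fin m → Option (Fin k) × Option (Fin k)) ,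
      MemLp (fun ω => ∏ i, W (E (f i)) ω) 2 P := fun m f => by
    have := hW.gaussian.isProbabilityMeasure
    exact memLp_two_prod _ fun i _ p hp => hW.memLp (hE _) (hE' _) hp
  -- a monomial in the cells has nonzero mean only if each cell occurs twice
  have hmono : ∀ φ ψ : Fin k → Option (Fin k),
      ∫ ω, (∏ i, W (E (some i, φ i)) ω) * ∏ j, W (E (ψ j, some j)) ω ∂P =
        ∑ σ : Equiv.Perm (Fin k), if φ = fun i => some (σ i) then
          if ψ = fun j => some (σ.symm j) then ∏ i, volume.real (E (some i, some (σ i))) else 0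
        else 0 := fun φ ψ => by
    have h := integral_prod_mul_prod_of_iIndepFun hind
      (fun a => (hW.hasGaussianLaw (hE a) (hE' a)).aemeasurable)
      (fun a => hW.mean _ (hE a) (hE' a))
      (Finset.univ.image (fun i => (some i, φ i))) (Finset.univ.image (fun j => (ψ j, some j)))
    have i1 : Function.Injective fun i : Fin k => (some i, φ i) := fun i j hij => by
      simpa using (Prod.ext_iff.1 hij).1
    have i2 : Function.Injective fun j : Fin k => (ψ j, some j) := fun i j hij => by
      simpa using (Prod.ext_iff.1 hij).2
    simp_rw [image_some_fst_eq_image_some_snd_iff, Finset.prod_image i1.injOn,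
      Finset.prod_image i2.injOn] at h
    rw [h]
    split_ifs with hσ
    · obtain ⟨σ, rfl, rfl⟩ := hσ
      rw [Finset.sum_eq_single σ]
      · rw [if_pos rfl, if_pos rfl]
        refine Finset.prod_congr rfl fun i _ => ?_
        rw [hW.covariance _ _ (hE _) (hE' _) (hE _) (hE' _), inter_self]
      · intro τ _ hτ
        refine if_neg fun h => hτ (Equiv.ext fun i => ?_)
        exact (Option.some_injective _ (congrFun h i)).symm
      · simp
    · refine (Finset.sum_eq_zero fun σ _ => ?_).symm
      split_ifs with h1 h2
      · exact absurd ⟨σ, h1, h2⟩ hσ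
      · rfl
      · rfl
  simp_rw [Finset.prod_univ_sum, Fintype.piFinset_univ, Finset.sum_mul_sum]
  have hi : ∀ φ ψ : Fin k → Option (Fin k), Integrable (fun ω =>
      (∏ i, W (E (some i, φ i)) ω) * ∏ j, W (E (ψ j, some j)) ω) P := fun φ ψ =>
    (hLp k fun i => (some i, φ i)).integrable_mul (hLp k fun j => (ψ j, some j))
  rw [integral_finsetSum _ fun φ _ => integrable_finsetSum _ fun ψ _ => hi φ ψ]
  simp_rw [integral_finsetSum Finset.univ fun ψ _ => hi _ ψ, hmono]
  simp_rw [Finset.sum_comm (s := (Finset.univ : Finset (Fin k → Option (Fin k))))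
    (t := (Finset.univ : Finset (Equiv.Perm (Fin k))))]
  refine Finset.sum_congr rfl fun σ _ => ?_
  rw [Finset.sum_eq_single fun i => some (σ i)]
  · simp
  · intro φ _ hφ
    simp [hφ]
  · simp

/-- The mean of the product of the elementary multiple integrals of two rectangles. -/
theorem integral_prod_mul_prod (hW : IsGaussianWhiteNoise W P) {k : ℕ}
    (R S : OffDiagonalRectangle k) :
    ∫ ω, (∏ i, W (R.side i) ω) * ∏ j, W (S.side j) ω ∂P
      = ∑ σ : Equiv.Perm (Fin k), ∏ i, volume.real (R.side i ∩ S.side (σ i)) := by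
  classical
  -- complete each family of sides to a partition of their total union `U`
  let U := (⋃ i, R.side i) ∪ ⋃ j, S.side j
  let r : Option (Fin k) → Set ℝ := fun a => a.elim (U \ ⋃ i, R.side i) R.side
  let s : Option (Fin k) → Set ℝ := fun b => b.elim (U \ ⋃ j, S.side j) S.side
  have hRm : MeasurableSet (⋃ i, R.side i) := MeasurableSet.iUnion R.measurableSet_side
  have hSm : MeasurableSet (⋃ i, S.side i) := MeasurableSet.iUnion S.measurableSet_side
  have hUm : MeasurableSet U := hRm.union hSm
  have hU : volume U ≠ ∞ := by
    refine measure_union_ne_top ?_ ?_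
    · exact ((measure_iUnion_fintype_le _ _).trans_lt
        (ENNReal.sum_lt_top.2 fun i _ => (R.volume_side_ne_top i).lt_top)).ne
    · exact ((measure_iUnion_fintype_le _ _).trans_lt
        (ENNReal.sum_lt_top.2 fun i _ => (S.volume_side_ne_top i).lt_top)).ne
  have hrm : ∀ a, MeasurableSet (r a) := fun a => by
    cases a with
    | none => exact hUm.diff hRm
    | some i => exact R.measurableSet_side i
  have hsm : ∀ a, MeasurableSet (s a) := fun a => by
    cases a with
    | none => exact hUm.diff hSm
    | some i => exact S.measurableSet_side i
  have hrd : Pairwise fun a b => Disjoint (r a) (r b) := fun a b hab => by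
    cases a with
    | none =>
      cases b with
      | none => exact absurd rfl hab
      | some j => exact disjoint_sdiff_left.mono_right (subset_iUnion R.side j)
    | some i =>
      cases b with
      | none => exact disjoint_sdiff_right.mono_left (subset_iUnion R.side i)
      | some j => exact R.disjoint_side i j fun h => hab (congrArg some h)
  have hsd : Pairwise fun a b => Disjoint (s a) (s b) := fun a b hab => by
    cases a with
    | none =>
      cases b with
      | none => exact absurd rfl hab
      | some j => exact disjoint_sdiff_left.mono_right (subset_iUnion S.side j)
    | some i =>
      cases b with
      | none => exact disjoint_sdiff_right.mono_left (subset_iUnion S.side i)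
      | some j => exact S.disjoint_side i j fun h => hab (congrArg some h)
  have hrU : ⋃ a, r a = U := by
    rw [iUnion_option]
    exact sdiff_union_of_subset subset_union_left
  have hsU : ⋃ a, s a = U := by
    rw [iUnion_option]
    exact sdiff_union_of_subset subset_union_right
  let E : Option (Fin k) × Option (Fin k) → Set ℝ := fun a => r a.1 ∩ s a.2
  have hE : ∀ a, MeasurableSet (E a) := fun a => (hrm a.1).inter (hsm a.2)
  have hE' : ∀ a, volume (E a) ≠ ∞ := fun a => measure_ne_top_of_subset
    (inter_subset_left.trans (hrU ▸ subset_iUnion r a.1)) hU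
  have hd : Pairwise fun a b => Disjoint (E a) (E b) := fun a b hab => by
    by_cases h1 : a.1 = b.1
    · have h2 : a.2 ≠ b.2 := fun h2 => hab (Prod.ext h1 h2)
      exact (hsd h2).mono inter_subset_right inter_subset_right
    · exact (hrd h1).mono inter_subset_left inter_subset_left
  have hR : ∀ i, W (R.side i) =ᵐ[P] fun ω => ∑ b, W (E (some i, b)) ω := fun i => by
    refine hW.ae_eq_sum (R.volume_side_ne_top i) (fun b => hE _)
      (fun b c hbc => hd fun h => hbc (Prod.ext_iff.1 h).2) ?_
    simp only [E]
    rw [← inter_iUnion, hsU]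
    exact (inter_eq_left.2 ((subset_iUnion R.side i).trans subset_union_left)).symm
  have hS : ∀ j, W (S.side j) =ᵐ[P] fun ω => ∑ a, W (E (a, some j)) ω := fun j => by
    refine hW.ae_eq_sum (S.volume_side_ne_top j) (fun b => hE _)
      (fun b c hbc => hd fun h => hbc (Prod.ext_iff.1 h).1) ?_
    simp only [E]
    rw [← iUnion_inter, hrU]
    exact (inter_eq_right.2 ((subset_iUnion S.side j).trans subset_union_right)).symm
  refine Eq.trans ?_ (hW.integral_prod_mul_prod_grid hE hE' hd)
  refine integral_congr_ae ?_
  filter_upwards [ae_all_iff.2 hR, ae_all_iff.2 hS] with ω h1 h2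
  simp_rw [h1, h2]

end IsGaussianWhiteNoise

/-! ### The multiple integral -/

section Hilbert

theorem inner_toLp_toLp {X : Type*} [MeasurableSpace X] {μ : Measure X} {f g : X → ℝ}
    (hf : MemLp f 2 μ) (hg : MemLp g 2 μ) :
    inner ℝ (hf.toLp f) (hg.toLp g) = ∫ x, f x * g x ∂μ := by
  rw [L2.inner_def]
  refine integral_congr_ae ?_
  filter_upwards [hf.coeFn_toLp, hg.coeFn_toLp] with x h1 h2
  simp [h1, h2, mul_comm]

theorem measurePreserving_comp_perm {k : ℕ} (σ : Equiv.Perm (Fin k)) :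
    MeasurePreserving (fun x : Fin k → ℝ => x ∘ σ) := by
  convert! volume_measurePreserving_piCongrLeft (fun _ : Fin k => ℝ) σ.symm using 1
  ext x i
  obtain ⟨j, rfl⟩ := σ.symm.surjective i
  rw [MeasurableEquiv.coe_piCongrLeft, Equiv.piCongrLeft_apply_apply]
  simp

/-- Permutation of the variables, as an isometry of `L²(ℝᵏ)`. -/
noncomputable def permLp {k : ℕ} (σ : Equiv.Perm (Fin k)) :
    Lp ℝ 2 (volume : Measure (Fin k → ℝ)) →ₗᵢ[ℝ] Lp ℝ 2 (volume : Measure (Fin k → ℝ)) :=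
  Lp.compMeasurePreservingₗᵢ ℝ (fun x => x ∘ σ) (measurePreserving_comp_perm σ)

theorem permLp_toLp {k : ℕ} (σ : Equiv.Perm (Fin k)) {f : (Fin k → ℝ) → ℝ} (hf : MemLp f 2) :
    permLp σ (hf.toLp f) = (hf.comp_measurePreserving (measurePreserving_comp_perm σ)).toLp _ :=
  rfl

end Hilbert

namespace OffDiagonalRectangle

variable {k : ℕ}

theorem measurableSet_pi (R : OffDiagonalRectangle k) : MeasurableSet (univ.pi R.side) :=
  MeasurableSet.univ_pi R.measurableSet_side

theorem volume_pi_ne_top (R : OffDiagonalRectangle k) : volume (univ.pi R.side) ≠ ∞ := by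
  rw [volume_pi_pi]
  exact ENNReal.prod_ne_top fun i _ => R.volume_side_ne_top i

theorem memLp_indicator (R : OffDiagonalRectangle k) :
    MemLp ((univ.pi R.side).indicator fun _ => (1 : ℝ)) 2 :=
  memLp_indicator_const 2 R.measurableSet_pi 1 (Or.inr R.volume_pi_ne_top)

theorem integral_indicator_mul_indicator_comp_perm (R S : OffDiagonalRectangle k)
    (σ : Equiv.Perm (Fin k)) :
    ∫ x, (univ.pi R.side).indicator (fun _ => (1 : ℝ)) x *
        (univ.pi S.side).indicator (fun _ => (1 : ℝ)) (x ∘ σ)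
      = ∏ i, volume.real (R.side i ∩ S.side (σ.symm i)) := by
  have h : ∀ x : Fin k → ℝ, (univ.pi R.side).indicator (fun _ => (1 : ℝ)) x *
      (univ.pi S.side).indicator (fun _ => (1 : ℝ)) (x ∘ σ)
      = (univ.pi fun i => R.side i ∩ S.side (σ.symm i)).indicator 1 x := fun x => by
    have e : x ∘ σ ∈ univ.pi S.side ↔ x ∈ univ.pi fun i => S.side (σ.symm i) := by
      simp only [mem_univ_pi, Function.comp_apply]
      exact ⟨fun h i => by simpa using h (σ.symm i), fun h i => by simpa using h (σ i)⟩
    rw [pi_inter_distrib]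
    by_cases h1 : x ∈ univ.pi R.side <;>
      by_cases h2 : x ∈ univ.pi fun i => S.side (σ.symm i) <;>
      simp only [indicator, e, h1, h2, mem_inter_iff] <;> simp
  simp_rw [h]
  rw [integral_indicator_one (MeasurableSet.univ_pi fun i =>
    (R.measurableSet_side i).inter (S.measurableSet_side _)), measureReal_def, volume_pi_pi,
    ENNReal.toReal_prod]
  rfl

end OffDiagonalRectangle

section Density

variable {k : ℕ}

/-- The diagonals of `ℝᵏ` are null. -/
theorem ae_injective : ∀ᵐ x : Fin k → ℝ, Function.Injective x := by
  have h : ∀ i j : Fin k, i ≠ j → ∀ᵐ x : Fin k → ℝ, x i ≠ x j := fun i j hij => by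
    let L : (Fin k → ℝ) →ₗ[ℝ] ℝ :=
      LinearMap.proj (R := ℝ) (φ := fun _ => ℝ) i - LinearMap.proj (R := ℝ) (φ := fun _ => ℝ) j
    have hL : LinearMap.ker L ≠ ⊤ := fun h => by
      have : Pi.single i (1 : ℝ) ∈ LinearMap.ker L := h ▸ Submodule.mem_top
      simp [L, hij.symm] at this
    have := Measure.addHaar_submodule (volume : Measure (Fin k → ℝ)) _ hL
    refine (measure_eq_zero_iff_ae_notMem.1 this).mono fun x hx he => hx ?_
    simp [L, he]
  have h' : ∀ᵐ x : Fin k → ℝ, ∀ i j, i ≠ j → x i ≠ x j :=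
    ae_all_iff.2 fun i => ae_all_iff.2 fun j => by
      by_cases hij : i = j
      · simp [hij]
      · simpa [hij] using h i j hij
  exact h'.mono fun x hx i j hij => by_contra fun hne => hx i j hne hij

/-- The set of points of `ℝ` whose grid cell of mesh `1 / (n + 1)` has the index `m`. -/
def gridCell (n : ℕ) (m : ℤ) : Set ℝ := {y | ⌊((n : ℝ) + 1) * y⌋ = m}

/-- A cube of mesh `1 / (n + 1)` off the diagonals. -/
def gridRectangle (n : ℕ) (m : Fin k → ℤ) (hm : Function.Injective m) :
    OffDiagonalRectangle k where
  side i := gridCell n (m i)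
  measurableSet_side i :=
    (Int.measurable_floor.comp (measurable_const.mul measurable_id)) (measurableSet_singleton _)
  volume_side_ne_top i := by
    have hfin : volume (Icc (m i / ((n : ℝ) + 1)) ((m i + 1) / ((n : ℝ) + 1))) ≠ ∞ :=
      measure_Icc_lt_top.ne
    refine measure_ne_top_of_subset (fun y hy => ?_) hfin
    have hy : ⌊((n : ℝ) + 1) * y⌋ = m i := hy
    have hn : (0 : ℝ) < n + 1 := by positivity
    obtain ⟨h1, h2⟩ := Int.floor_eq_iff.1 hy
    constructor
    · rw [div_le_iff₀ hn]; linarith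
    · rw [le_div_iff₀ hn]; linarith
  disjoint_side i j hij := disjoint_left.2 fun y h1 h2 => hij (hm (h1.symm.trans h2))

theorem exists_injective_floor {x : Fin k → ℝ} (hx : Function.Injective x) :
    ∃ n : ℕ, Function.Injective fun i => ⌊((n : ℝ) + 1) * x i⌋ := by
  have h : ∀ i j, ∃ N : ℕ, ∀ n : ℕ, N ≤ n → i ≠ j →
      ⌊((n : ℝ) + 1) * x i⌋ ≠ ⌊((n : ℝ) + 1) * x j⌋ := fun i j => by
    by_cases hij : i = j
    · exact ⟨0, fun _ _ h => absurd hij h⟩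
    have hpos : 0 < |x i - x j| := abs_pos.2 (sub_ne_zero.2 (hx.ne hij))
    obtain ⟨N, hN⟩ := exists_nat_gt (1 / |x i - x j|)
    refine ⟨N, fun n hn _ he => ?_⟩
    have h1 := Int.abs_sub_lt_one_of_floor_eq_floor he
    have hn' : (N : ℝ) ≤ n := by exact_mod_cast hn
    rw [← mul_sub, abs_mul, abs_of_pos (by positivity)] at h1
    rw [div_lt_iff₀ hpos] at hN
    nlinarith
  choose N hN using h
  refine ⟨Finset.univ.sup fun p : Fin k × Fin k => N p.1 p.2, fun i j he => ?_⟩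
  by_contra hij
  exact hN i j _ (Finset.le_sup (f := fun p : Fin k × Fin k => N p.1 p.2)
    (Finset.mem_univ (i, j))) hij he

/-- A function whose integrals over the off-diagonal rectangles vanish is null: on each cube off
the diagonals the measurable subrectangles generate the Borel sets, countably many such cubes cover
the complement of the diagonals, and the diagonals are null. -/
theorem ae_eq_zero_of_forall_setIntegral_pi_eq_zero {f : (Fin k → ℝ) → ℝ} (hf : MemLp f 2)
    (h : ∀ R : OffDiagonalRectangle k, ∫ x in univ.pi R.side, f x = 0) : f =ᵐ[volume] 0 := by
  have hbox : ∀ R : OffDiagonalRectangle k, ∀ᵐ x, x ∈ univ.pi R.side → f x = 0 := fun R => by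
    rw [← ae_restrict_iff' R.measurableSet_pi]
    have : IsFiniteMeasure (volume.restrict (univ.pi R.side)) :=
      isFiniteMeasure_restrict.2 R.volume_pi_ne_top
    have hi : Integrable f (volume.restrict (univ.pi R.side)) :=
      (hf.restrict _).integrable one_le_two
    refine hi.ae_eq_zero_of_forall_setIntegral_eq_zero fun s hs _ => ?_
    refine MeasurableSpace.induction_on_inter
      (C := fun s _ => ∫ x in s, f x ∂volume.restrict (univ.pi R.side) = 0)
      generateFrom_pi.symm isPiSystem_pi (by simp) ?_ ?_ ?_ s hs
    · rintro _ ⟨t, ht, rfl⟩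
      have ht : ∀ i, MeasurableSet (t i) := fun i => ht i (mem_univ i)
      rw [Measure.restrict_restrict (MeasurableSet.univ_pi ht), ← pi_inter_distrib]
      exact h ⟨fun i => t i ∩ R.side i, fun i => (ht i).inter (R.measurableSet_side i),
        fun i => measure_ne_top_of_subset inter_subset_right (R.volume_side_ne_top i),
        fun i j hij => (R.disjoint_side i j hij).mono inter_subset_right inter_subset_right⟩
    · intro t ht ih
      have := integral_add_compl ht hi
      rwa [ih, zero_add, h R] at this
    · intro t hd ht ih
      rw [integral_iUnion ht hd hi.integrableOn]
      simp [ih]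
  have hall : ∀ᵐ x, ∀ (n : ℕ) (m : {m : Fin k → ℤ // Function.Injective m}),
      x ∈ univ.pi (gridRectangle n m.1 m.2).side → f x = 0 :=
    ae_all_iff.2 fun n => ae_all_iff.2 fun m => hbox _
  filter_upwards [hall, ae_injective] with x hx hinj
  obtain ⟨n, hn⟩ := exists_injective_floor hinj
  exact hx n ⟨_, hn⟩ fun i _ => rfl

end Density

namespace ElementaryIntegrand

variable {k : ℕ}

/-- The class in `L²(ℝᵏ)` of an elementary integrand. -/
noncomputable def toLp : ElementaryIntegrand k →ₗ[ℝ] Lp ℝ 2 (volume : Measure (Fin k → ℝ)) :=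
  Finsupp.linearCombination ℝ fun R => R.memLp_indicator.toLp _

theorem coeFn_toLp (F : ElementaryIntegrand k) : toLp F =ᵐ[volume] F.toFun := by
  induction F using Finsupp.induction_linear with
  | zero =>
    rw [map_zero]
    filter_upwards [Lp.coeFn_zero ℝ 2 (volume : Measure (Fin k → ℝ))] with x hx
    rw [hx]; simp [toFun]
  | add F G hF hG =>
    rw [map_add]
    filter_upwards [Lp.coeFn_add (toLp F) (toLp G), hF, hG] with x hx h1 h2
    rw [hx, Pi.add_apply, h1, h2, toFun, toFun, toFun,
      Finsupp.sum_add_index' (by simp) (by intros; ring)]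
  | single R c =>
    rw [toLp, Finsupp.linearCombination_single]
    filter_upwards [Lp.coeFn_smul c (R.memLp_indicator.toLp _), R.memLp_indicator.coeFn_toLp]
      with x hx h1
    rw [hx, Pi.smul_apply, h1, toFun, Finsupp.sum_single_index (by simp), smul_eq_mul]

theorem denseRange_toLp : DenseRange (toLp (k := k)) := by
  have h : (LinearMap.range (toLp (k := k))).topologicalClosure = ⊤ := by
    rw [Submodule.topologicalClosure_eq_top_iff, Submodule.eq_bot_iff]
    intro f hf
    rw [Lp.eq_zero_iff_ae_eq_zero]
    refine ae_eq_zero_of_forall_setIntegral_pi_eq_zero (Lp.memLp f) fun R => ?_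
    have h1 := (Submodule.mem_orthogonal _ _).1 hf (toLp (Finsupp.single R 1))
      (LinearMap.mem_range_self _ _)
    rw [toLp, Finsupp.linearCombination_single, one_smul, ← Lp.toLp_coeFn f (Lp.memLp f),
      inner_toLp_toLp] at h1
    rw [← h1, ← integral_indicator R.measurableSet_pi]
    congr 1 with x
    by_cases hx : x ∈ univ.pi R.side
    · rw [indicator_of_mem hx, indicator_of_mem hx, one_mul]
    · rw [indicator_of_notMem hx, indicator_of_notMem hx, zero_mul]
  have h2 := Submodule.dense_iff_topologicalClosure_eq_top.2 h
  rwa [LinearMap.coe_range] at h2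

theorem tendsto_toLp_iff {f : (Fin k → ℝ) → ℝ} (hf : MemLp f 2)
    {F : ℕ → ElementaryIntegrand k} :
    Tendsto (fun n => toLp (F n)) atTop (𝓝 (hf.toLp f)) ↔
      Tendsto (fun n => eLpNorm (fun x => f x - (F n).toFun x) 2 volume) atTop (𝓝 0) := by
  rw [Lp.tendsto_Lp_iff_tendsto_eLpNorm]
  refine tendsto_congr fun n => ?_
  rw [eLpNorm_sub_comm]
  refine eLpNorm_congr_ae ?_
  filter_upwards [coeFn_toLp (F n)] with x hx
  rw [Pi.sub_apply, hx]

end ElementaryIntegrand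

namespace IsGaussianWhiteNoise

variable {Ω : Type*} [MeasurableSpace Ω] {P : Measure Ω} {W : Set ℝ → Ω → ℝ} {k : ℕ}

theorem memLp_prod (hW : IsGaussianWhiteNoise W P) (R : OffDiagonalRectangle k) :
    MemLp (fun ω => ∏ i, W (R.side i) ω) 2 P := by
  have := hW.gaussian.isProbabilityMeasure
  exact memLp_two_prod _ fun i _ p hp =>
    hW.memLp (R.measurableSet_side i) (R.volume_side_ne_top i) hp

/-- The class in `L²(P)` of the multiple integral of an elementary integrand. -/
noncomputable def integralLp (hW : IsGaussianWhiteNoise W P) :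
    ElementaryIntegrand k →ₗ[ℝ] Lp ℝ 2 P :=
  Finsupp.linearCombination ℝ fun R => (hW.memLp_prod R).toLp _

theorem coeFn_integralLp (hW : IsGaussianWhiteNoise W P) (F : ElementaryIntegrand k) :
    hW.integralLp F =ᵐ[P] F.integral W := by
  induction F using Finsupp.induction_linear with
  | zero =>
    rw [map_zero]
    filter_upwards [Lp.coeFn_zero ℝ 2 P] with x hx
    rw [hx]; simp [ElementaryIntegrand.integral]
  | add F G hF hG =>
    rw [map_add]
    filter_upwards [Lp.coeFn_add (hW.integralLp F) (hW.integralLp G), hF, hG] with x hx h1 h2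
    rw [hx, Pi.add_apply, h1, h2, ElementaryIntegrand.integral, ElementaryIntegrand.integral,
      ElementaryIntegrand.integral, Finsupp.sum_add_index' (by simp) (by intros; ring)]
  | single R c =>
    rw [integralLp, Finsupp.linearCombination_single]
    filter_upwards [Lp.coeFn_smul c ((hW.memLp_prod R).toLp _), (hW.memLp_prod R).coeFn_toLp]
      with x hx h1
    rw [hx, Pi.smul_apply, h1, ElementaryIntegrand.integral, Finsupp.sum_single_index (by simp),
      smul_eq_mul]

theorem tendsto_integralLp_iff (hW : IsGaussianWhiteNoise W P) {X : Ω → ℝ} (hX : MemLp X 2 P)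
    {F : ℕ → ElementaryIntegrand k} :
    Tendsto (fun n => hW.integralLp (F n)) atTop (𝓝 (hX.toLp X)) ↔
      Tendsto (fun n => eLpNorm (fun ω => X ω - (F n).integral W ω) 2 P) atTop (𝓝 0) := by
  rw [Lp.tendsto_Lp_iff_tendsto_eLpNorm]
  refine tendsto_congr fun n => ?_
  rw [eLpNorm_sub_comm]
  refine eLpNorm_congr_ae ?_
  filter_upwards [hW.coeFn_integralLp (F n)] with x hx
  rw [Pi.sub_apply, hx]

/-- The isometry formula for elementary integrands. -/
theorem inner_integralLp (hW : IsGaussianWhiteNoise W P) (F G : ElementaryIntegrand k) :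
    inner ℝ (hW.integralLp F) (hW.integralLp G)
      = ∑ σ : Equiv.Perm (Fin k), inner ℝ F.toLp (permLp σ G.toLp) := by
  induction F using Finsupp.induction_linear with
  | zero => simp
  | add F F' hF hF' => simp_rw [map_add, inner_add_left, hF, hF', Finset.sum_add_distrib]
  | single R c =>
    induction G using Finsupp.induction_linear with
    | zero => simp
    | add G G' hG hG' => simp_rw [map_add, inner_add_right, hG, hG', Finset.sum_add_distrib]
    | single S d =>
      simp_rw [integralLp, ElementaryIntegrand.toLp, Finsupp.linearCombination_single, map_smul,
        inner_smul_left, inner_smul_right, permLp_toLp, inner_toLp_toLp, ← Finset.mul_sum]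
      rw [hW.integral_prod_mul_prod R S,
        ← Equiv.sum_comp (Equiv.inv (Equiv.Perm (Fin k)))]
      congr 2
      refine Finset.sum_congr rfl fun σ _ => ?_
      exact (R.integral_indicator_mul_indicator_comp_perm S σ).symm

theorem norm_integralLp_sq_le (hW : IsGaussianWhiteNoise W P) (F : ElementaryIntegrand k) :
    ‖hW.integralLp F‖ ^ 2 ≤ k.factorial * ‖F.toLp‖ ^ 2 := by
  rw [← real_inner_self_eq_norm_sq, hW.inner_integralLp]
  refine (Finset.sum_le_card_nsmul _ _ (‖F.toLp‖ ^ 2) fun σ _ => ?_).trans_eq ?_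
  · refine (real_inner_le_norm _ _).trans_eq ?_
    rw [LinearIsometry.norm_map, sq]
  · rw [Finset.card_univ, Fintype.card_perm, Fintype.card_fin, nsmul_eq_mul]

/-- Every function in `L²(ℝᵏ)` has a multiple Wiener–Itô integral. -/
theorem exists_isMultipleWienerIntegral (hW : IsGaussianWhiteNoise W P) {f : (Fin k → ℝ) → ℝ}
    (hf : MemLp f 2) : ∃ X, IsMultipleWienerIntegral W P f X := by
  obtain ⟨u, hu, hlim⟩ := mem_closure_iff_seq_limit.1
    (ElementaryIntegrand.denseRange_toLp (hf.toLp f))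
  choose F hF using hu
  have hFlim : Tendsto (fun n => (F n).toLp) atTop (𝓝 (hf.toLp f)) := by simpa only [hF] using hlim
  have hc : CauchySeq fun n => hW.integralLp (F n) := by
    have hb : ∀ m n, ‖hW.integralLp (F m) - hW.integralLp (F n)‖
        ≤ √k.factorial * ‖(F m).toLp - (F n).toLp‖ := fun m n => by
      rw [← map_sub, ← map_sub]
      refine le_of_sq_le_sq ?_ (by positivity)
      rw [mul_pow, Real.sq_sqrt (by positivity)]
      exact hW.norm_integralLp_sq_le _
    have h0 := cauchySeq_iff_tendsto_dist_atTop_0.1 hFlim.cauchySeq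
    refine cauchySeq_iff_tendsto_dist_atTop_0.2 (squeeze_zero (fun _ => dist_nonneg)
      (fun p => ?_) (by simpa using h0.const_mul √(k.factorial : ℝ)))
    rw [dist_eq_norm, dist_eq_norm]
    exact hb p.1 p.2
  obtain ⟨Y, hY⟩ := cauchySeq_tendsto_of_complete hc
  refine ⟨Y, hf, Lp.memLp Y, F, (ElementaryIntegrand.tendsto_toLp_iff hf).1 hFlim,
    (hW.tendsto_integralLp_iff (Lp.memLp Y)).1 ?_⟩
  rwa [Lp.toLp_coeFn]

/-- The isometry formula for the multiple integral. Symmetry of one of the functions is enough. -/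
theorem integral_mul_of_isMultipleWienerIntegral (hW : IsGaussianWhiteNoise W P)
    {f g : (Fin k → ℝ) → ℝ} {X Y : Ω → ℝ} (hX : IsMultipleWienerIntegral W P f X)
    (hY : IsMultipleWienerIntegral W P g Y)
    (hg : ∀ (σ : Equiv.Perm (Fin k)) (x : Fin k → ℝ), g (x ∘ σ) = g x) :
    ∫ ω, X ω * Y ω ∂P = k.factorial * ∫ x, f x * g x := by
  obtain ⟨hf, hX, F, hF, hFX⟩ := hX
  obtain ⟨hg', hY, G, hG, hGY⟩ := hY
  rw [← ElementaryIntegrand.tendsto_toLp_iff hf] at hF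
  rw [← ElementaryIntegrand.tendsto_toLp_iff hg'] at hG
  rw [← hW.tendsto_integralLp_iff hX] at hFX
  rw [← hW.tendsto_integralLp_iff hY] at hGY
  have h1 := hFX.inner (𝕜 := ℝ) hGY
  have h2 : Tendsto (fun n => ∑ σ : Equiv.Perm (Fin k), inner ℝ (F n).toLp (permLp σ (G n).toLp))
      atTop (𝓝 (∑ σ : Equiv.Perm (Fin k), inner ℝ (hf.toLp f) (permLp σ (hg'.toLp g)))) :=
    tendsto_finsetSum _ fun σ _ =>
      hF.inner (((permLp σ).continuous.tendsto _).comp hG)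
  simp_rw [hW.inner_integralLp] at h1
  have h3 := tendsto_nhds_unique h1 h2
  rw [inner_toLp_toLp] at h3
  rw [h3]
  simp_rw [permLp_toLp, inner_toLp_toLp, Function.comp_apply, hg]
  rw [Finset.sum_const, Finset.card_univ, Fintype.card_perm, Fintype.card_fin, nsmul_eq_mul]

end IsGaussianWhiteNoise

/-! ### The covariance of the tempered process -/

/-- Besides the covariance formula, the conclusion records that all the integrals in it exist. -/
theorem lemma3p4 {Ω : Type*} [MeasurableSpace Ω] (P : Measure Ω) [IsProbabilityMeasure P]
    (W : Set ℝ → Ω → ℝ) (hW : IsGaussianWhiteNoise W P)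
    (k : ℕ) (hk : 1 ≤ k) (α lam : ℝ) (hlam : 0 < lam)
    (g : (Fin k → ℝ) → ℝ) (hg : IsTemperedHermiteKernel k α lam g)
    (g₁ : ℝ → ℝ) (hg₁ : g₁ 0 = 0)
    (hprod : ∀ x ∈ positiveOrthant k, g x = ∏ i, g₁ (x i)) :
    (∀ t : ℝ, IsMultipleWienerIntegral W P (temperedKernel g lam t)
      (temperedHermiteProcess W P g lam t)) ∧
    (∀ r : ℝ, 0 < r →
      IntegrableOn (fun x : ℝ => g₁ x * g₁ (1 + x) * Real.exp (-2 * lam * r * x))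
        (Set.Ioi 0) volume) ∧
    ∀ t s : ℝ,
      Integrable (fun ω => temperedHermiteProcess W P g lam t ω *
        temperedHermiteProcess W P g lam s ω) P ∧
      IntegrableOn (fun p : ℝ × ℝ => covarianceIntegrand k α lam g₁ |p.1 - p.2|)
        (Set.uIoc 0 s ×ˢ Set.uIoc 0 t) volume ∧
      ∫ ω, temperedHermiteProcess W P g lam t ω * temperedHermiteProcess W P g lam s ω ∂P =
        (k.factorial : ℝ) *
          ∫ v in (0 : ℝ)..t, ∫ u in (0 : ℝ)..s, covarianceIntegrand k α lam g₁ |u - v| := by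
  have hα := hg.exponent_mem
  obtain ⟨C, hC⟩ := hg.exists_eq_const_mul_rpow hk hprod
  obtain ⟨h1, h2⟩ := neg_one_lt_exponent_div_lt hk hα
  -- the value chosen in the definition of the process is a genuine integral, not the default `0`
  have hZ : ∀ t, IsMultipleWienerIntegral W P (temperedKernel g lam t)
      (temperedHermiteProcess W P g lam t) := fun t => by
    have h := hW.exists_isMultipleWienerIntegral
      (memLp_two_temperedKernel hk hα hlam hC hprod t)
    rw [temperedHermiteProcess, multipleWienerIntegral, dif_pos h]
    exact h.choose_spec
  refine ⟨hZ, fun r hr => integrableOn_mul_shift_mul_exp hC h1 h2 hlam hr.le, fun t s =>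
    ⟨(hZ t).2.1.integrable_mul (hZ s).2.1, integrableOn_covarianceIntegrand hk hα hlam hC s t, ?_⟩⟩
  rw [hW.integral_mul_of_isMultipleWienerIntegral (hZ t) (hZ s)
    (fun σ x => temperedKernel_comp_perm hprod s σ x),
    (integral_mul_temperedKernel hk hα hlam hC hprod t s).2]
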